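/- Let $X$ be a uniformly convex complex Banach space with dual $X^*$, let $K$ be a compact Hausdorff space, and let $C(K,X)$ be the space of norm-continuous functions $K\to X$ with the supremum norm. Let $A(K,X)\subset C(K,X)$ be an $X$-valued function space over a uniform algebra, that is, a closed linear subspace of $C(K,X)$ such that the base algebra $A=\{y^*\circ f: f\in A(K,X),\ y^*\in X^*\}$ is a uniform algebra on $K$ (a closed subalgebra of $C(K,\mathbb{C})$ that contains the constants and separates the points of $K$), and such that $\phi f\in A(K,X)$ for all $\phi\in A$ and $f\in A(K,X)$. Let $\Gamma$ be the Shilov boundary of $A$, i.e. the intersection of all closed sets $S\subset K$ such that every $f\in A$ satisfies $|f(t)|=\|f\|_\infty$ for some $t\in S$. For a Banach space $E$ with closed unit ball $B_E$ and unit sphere $S_E$, say that $E$ has - the Daugavet property if $\|I+T\|=1+\|T\|$ for every rank-one bounded linear operator $T:E\to E$; - the DD2P (diametral diameter two property) if for every relatively weakly open set $U\subset B_E$, every $x\in S_E\cap U$ and every $\varepsilon>0$ there is $y\in U$ with $\|x-y\|\ge 2-\varepsilon$; - the DLD2P (diametral local diameter two property) if the same holds for every slice $U=\{x\in B_E:\operatorname{Re}x^*(x)>1-\alpha\}$,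 where $x^*\in S_{E^*}$ and $\alpha>0$. Consider the following statements: (i) $A(K,X)$ has the Daugavet property; (ii) $A(K,X)$ has the DD2P; (iii) $A(K,X)$ has the DLD2P; (iv) $\Gamma$ has no isolated points. Then (i) $\Rightarrow$ (ii) $\Rightarrow$ (iii) $\Rightarrow$ (iv). Moreover, if $A\otimes X\subset A(K,X)$, i.e. if the function $t\mapsto\phi(t)x$ belongs to $A(K,X)$ for all $\phi\in A$ and $x\in X$, then (i), (ii), (iii) and (iv) are equivalent. -/

import Mathlib

section UniformAlgebras

variable {K : Type*} [TopologicalSpace K] [CompactSpace K]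

/-- A set `A` of complex-valued continuous functions on a compact space `K` is a *uniform algebra*
if it is a (uniformly) closed subalgebra of `C(K, ℂ)` that separates the points of `K` and contains
the constant functions (the latter is part of `Subalgebra ℂ C(K, ℂ)`). -/
def IsUniformAlgebra (A : Set C(K, ℂ)) : Prop :=
  ∃ B : Subalgebra ℂ C(K, ℂ), (B : Set C(K, ℂ)) = A ∧ IsClosed A ∧ B.SeparatesPoints

/-- `S ⊆ K` is a *boundary* for `A` if every `f ∈ A` attains its supremum norm at a point
of `S`. -/
def IsBoundaryFor (A : Set C(K, ℂ)) (S : Set K) : Prop :=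
  ∀ f ∈ A, ∃ t ∈ S, ‖f t‖ = ‖f‖

/-- The *Shilov boundary* of `A`: the intersection of all closed boundaries for `A`. -/
def shilovBoundary (A : Set C(K, ℂ)) : Set K :=
  ⋂₀ {S : Set K | IsClosed S ∧ IsBoundaryFor A S}

variable {X : Type*} [NormedAddCommGroup X] [NormedSpace ℂ X]

/-- The *base algebra* `{y* ∘ f : f ∈ M, y* ∈ X*}` of a space `M` of `X`-valued continuous
functions. -/
def baseAlgebra (M : Submodule ℂ C(K, X)) : Set C(K, ℂ) :=
  {φ | ∃ f ∈ M, ∃ y : StrongDual ℂ X, ∀ t, φ t = y (f t)}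

/-- `M` is an *`X`-valued function space over a uniform algebra*: a closed subspace of `C(K, X)`
(with the supremum norm) whose base algebra is a uniform algebra on `K`, and which is stable under
pointwise multiplication `(φ • f) t = φ t • f t` by the functions `φ` of the base algebra. -/
structure IsFunctionSpaceOverUniformAlgebra (M : Submodule ℂ C(K, X)) : Prop where
  isClosed : IsClosed (M : Set C(K, X))
  isUniformAlgebra_base : IsUniformAlgebra (baseAlgebra M)
  smul_mem : ∀ φ ∈ baseAlgebra M, ∀ f ∈ M, φ • f ∈ M

/-- The condition `A ⊗ X ⊆ M` for the base algebra `A` of `M`: every function `t ↦ φ t • x` with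
`φ ∈ A` and `x ∈ X` belongs to `M`. -/
def ContainsBaseTensor (M : Submodule ℂ C(K, X)) : Prop :=
  ∀ φ ∈ baseAlgebra M, ∀ x : X, φ • ContinuousMap.const K x ∈ M

end UniformAlgebras

section DiameterTwo

variable (E : Type*) [NormedAddCommGroup E] [NormedSpace ℂ E]

/-- The *Daugavet property*: `‖I + T‖ = 1 + ‖T‖` for every bounded operator `T` of rank one. -/
def HasDaugavetProperty : Prop :=
  ∀ T : E →L[ℂ] E, Module.finrank ℂ (LinearMap.range (T : E →ₗ[ℂ] E)) = 1 →
    ‖ContinuousLinearMap.id ℂ E + T‖ = 1 + ‖T‖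

variable {E} in
/-- The slice `{x ∈ B_E : Re (φ x) > 1 - α}` of the closed unit ball. -/
def ballSlice (φ : StrongDual ℂ E) (α : ℝ) : Set E :=
  {x | ‖x‖ ≤ 1 ∧ 1 - α < (φ x).re}

/-- The *diametral local diameter two property*: for every slice `S` of the unit ball, every
unit vector `x ∈ S` and every `ε > 0` there is `y ∈ S` with `‖x - y‖ ≥ 2 - ε`. -/
def HasDLD2P : Prop :=
  ∀ φ : StrongDual ℂ E, ‖φ‖ = 1 → ∀ α : ℝ, 0 < α →
    ∀ x ∈ ballSlice φ α, ‖x‖ = 1 → ∀ ε : ℝ, 0 < ε →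
      ∃ y ∈ ballSlice φ α, 2 - ε ≤ ‖x - y‖

/-- The *diametral diameter two property*: for every relatively weakly open subset `U` of the unit
ball, every unit vector `x ∈ U` and every `ε > 0` there is `y ∈ U` with `‖x - y‖ ≥ 2 - ε`. Here
`U` is the intersection of the unit ball with a set `V` that is open in the weak topology. -/
def HasDD2P : Prop :=
  ∀ V : Set (WeakSpace ℂ E), IsOpen V →
    ∀ U : Set E, U = Metric.closedBall 0 1 ∩ toWeakSpace ℂ E ⁻¹' V →
      ∀ x ∈ U, ‖x‖ = 1 → ∀ ε : ℝ, 0 < ε → ∃ y ∈ U, 2 - ε ≤ ‖x - y‖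

end DiameterTwo

/-! The implications run (i) ⇒ (iii) ⇒ (iv) ⇒ (ii) ⇒ (iii), and with tensors (iv) ⇒ (i); so (i) ⇒
(ii) passes through the boundary.

Functions of `M` attain their norms on `Γ` (`exists_norm_eq_of_mem_shilovBoundary`). At an isolated
point `t₀` the algebra contains a function that on `Γ` is the indicator of `t₀`. It yields a
norm-one `g` in `M` vanishing on the rest of `Γ`. Uniform convexity at `t₀` then makes every element
of a suitable slice stay within distance 1 of `g`, against the DLD2P.

If `Γ` has no isolated points, any open set meeting it contains infinitely many open pieces with
disjoint traces on `Γ`. Functions `ψ n` peaking in these pieces multiply bounded sequences to weakly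
null ones (`tendsto_apply_baseMul_of_pairwise_disjoint`). A logarithm keeps their values near `[0,
1]`, so replacing `f` by `(1 - ψ n) f + ψ n v` with `‖f‖, ‖v‖ ≤ 1` costs almost no norm. Taking `v =
-g`, `f = g` gives the DD2P; a constant `v` gives the Daugavet property. -/

open Filter Topology

/-! ### The Shilov boundary and peaking functions -/

section ShilovBoundary

variable {K : Type*} [TopologicalSpace K] [CompactSpace K]

/-- On a nonempty compact space, every set of continuous functions has a minimal closed boundary. -/
theorem exists_minimal_isClosed_isBoundaryFor [Nonempty K] (A : Set C(K, ℂ)) :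
    ∃ S : Set K, Minimal (fun S => S ∈ {S : Set K | IsClosed S ∧ IsBoundaryFor A S}) S := by
  have huniv : (Set.univ : Set K) ∈ {S : Set K | IsClosed S ∧ IsBoundaryFor A S} := by
    refine ⟨isClosed_univ, fun f _ => ?_⟩
    obtain ⟨t, -, ht⟩ := isCompact_univ.exists_isMaxOn (Set.univ_nonempty (α := K))
      (f := fun t => ‖f t‖) (by fun_prop)
    exact ⟨t, trivial, le_antisymm (f.norm_coe_le_norm t)
      ((f.norm_le (norm_nonneg _)).2 fun s => ht (Set.mem_univ s))⟩
  obtain ⟨S, -, hS⟩ := zorn_superset_nonempty {S : Set K | IsClosed S ∧ IsBoundaryFor A S} (by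
    intro c hc hchain hne
    refine ⟨⋂₀ c, ⟨isClosed_sInter fun s hs => (hc hs).1, fun f hf => ?_⟩,
      fun s hs => Set.sInter_subset_of_mem hs⟩
    have hcl : IsClosed {t : K | ‖f t‖ = ‖f‖} :=
      isClosed_eq (by fun_prop) continuous_const
    -- By compactness, the maximum sets of `|f|` in the members of the chain have a common point.
    have : Nonempty ((fun s => s ∩ {t : K | ‖f t‖ = ‖f‖}) '' c) := (hne.image _).to_subtype
    obtain ⟨t, ht⟩ := IsCompact.nonempty_sInter_of_directed_nonempty_isCompact_isClosed
      (S := (fun s => s ∩ {t : K | ‖f t‖ = ‖f‖}) '' c) (by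
        rintro _ ⟨s, hs, rfl⟩ _ ⟨s', hs', rfl⟩
        rcases hchain.total hs hs' with h | h
        · exact ⟨_, ⟨s, hs, rfl⟩, le_rfl, Set.inter_subset_inter_left _ h⟩
        · exact ⟨_, ⟨s', hs', rfl⟩, Set.inter_subset_inter_left _ h, le_rfl⟩)
      (by
        rintro _ ⟨s, hs, rfl⟩
        obtain ⟨t, hts, ht⟩ := (hc hs).2 f hf
        exact ⟨t, hts, ht⟩)
      (by
        rintro _ ⟨s, hs, rfl⟩
        exact ((hc hs).1.inter hcl).isCompact)
      (by
        rintro _ ⟨s, hs, rfl⟩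
        exact (hc hs).1.inter hcl)
    obtain ⟨s₀, hs₀⟩ := hne
    exact ⟨t, fun s hs => (ht _ ⟨s, hs, rfl⟩).1, (ht _ ⟨s₀, hs₀, rfl⟩).2⟩) _ huniv
  exact ⟨S, hS⟩

/-- If a closed set `S` is not a boundary for the algebra `B`, some norm-one function in `B`
has modulus bounded by a constant `r < 1` on `S`. -/
theorem exists_norm_eq_one_of_not_isBoundaryFor (B : Subalgebra ℂ C(K, ℂ)) {S : Set K}
    (hS : IsClosed S) (hB : ¬ IsBoundaryFor (B : Set C(K, ℂ)) S) (hne : Nonempty K) :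
    ∃ f ∈ B, ‖f‖ = 1 ∧ ∃ r, 0 ≤ r ∧ r < 1 ∧ ∀ t ∈ S, ‖f t‖ ≤ r := by
  unfold IsBoundaryFor at hB
  push Not at hB
  obtain ⟨f, hf, hlt⟩ := hB
  rcases S.eq_empty_or_nonempty with rfl | hSne
  · exact ⟨1, B.one_mem, norm_one, 0, le_rfl, one_pos, by simp⟩
  have hf0 : 0 < ‖f‖ := by
    rcases (norm_nonneg f).eq_or_lt with h | h
    · obtain ⟨t, ht⟩ := hSne
      exact absurd (le_antisymm (f.norm_coe_le_norm t) (h ▸ norm_nonneg _)) (hlt t ht)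
    · exact h
  obtain ⟨s, hs, hmax⟩ := hS.isCompact.exists_isMaxOn hSne
    (f := fun t => ‖f t‖) (by fun_prop)
  refine ⟨((‖f‖ : ℂ)⁻¹) • f, B.smul_mem hf _, ?_, ‖f‖⁻¹ * ‖f s‖, by positivity, ?_, fun t ht => ?_⟩
  · rw [norm_smul, norm_inv, Complex.norm_real, norm_norm, inv_mul_cancel₀ hf0.ne']
  · rw [inv_mul_lt_iff₀ hf0, mul_one]
    exact lt_of_le_of_ne (f.norm_coe_le_norm s) (hlt s hs)
  · rw [ContinuousMap.smul_apply, norm_smul, norm_inv, Complex.norm_real, norm_norm]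
    gcongr
    exact hmax ht

/-- Shilov's theorem: the Shilov boundary of a point separating algebra is a boundary. -/
theorem isBoundaryFor_shilovBoundary [hK : Nonempty K] (B : Subalgebra ℂ C(K, ℂ))
    (hsep : B.SeparatesPoints) :
    IsBoundaryFor (B : Set C(K, ℂ)) (shilovBoundary (B : Set C(K, ℂ))) := by
  obtain ⟨S₀, hmin⟩ := exists_minimal_isClosed_isBoundaryFor (B : Set C(K, ℂ))
  obtain ⟨hS₀, hS₀B⟩ := hmin.prop
  suffices h : S₀ ⊆ shilovBoundary (B : Set C(K, ℂ)) by
    intro f hf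
    obtain ⟨t, ht, h'⟩ := hS₀B f hf
    exact ⟨t, h ht, h'⟩
  rintro t₀ ht₀ S ⟨hS, hSB⟩
  by_contra hts
  -- The value 2 leaves room for `|F s| > 1` near `s`, while `F s` vanishes at `t₀`; off `S` the
  -- choice 0 is only a filler.
  have hfun : ∀ s : K, ∃ f ∈ B, f t₀ = 0 ∧ (s ∈ S → f s = 2) := by
    intro s
    by_cases hs : s ∈ S
    · have hne : s ≠ t₀ := fun h => hts (h ▸ hs)
      obtain ⟨_, ⟨f, hf, rfl⟩, hfs⟩ := hsep hne
      have hne' : f s - f t₀ ≠ 0 := sub_ne_zero.2 hfs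
      refine ⟨(2 / (f s - f t₀)) • (f - algebraMap ℂ C(K, ℂ) (f t₀)),
        B.smul_mem (B.sub_mem hf (B.algebraMap_mem _)) _, ?_, fun _ => ?_⟩
      · simp
      · simp [hne']
    · exact ⟨0, B.zero_mem, rfl, fun h => absurd h hs⟩
  choose F hFB hF0 hF2 using hfun
  obtain ⟨I, -, hI⟩ := hS.isCompact.elim_nhds_subcover (fun s => {t | 1 < ‖F s t‖}) (by
    intro s hs
    refine (isOpen_lt continuous_const (by fun_prop)).mem_nhds ?_
    simp [hF2 s hs])
  let V : Set K := ⋂ s ∈ I, {t | ‖F s t‖ < 1}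
  have hV : IsOpen V :=
    isOpen_biInter_finset fun s _ => isOpen_lt (by fun_prop) continuous_const
  have htV : t₀ ∈ V := by simp [V, hF0]
  have hnb : ¬ IsBoundaryFor (B : Set C(K, ℂ)) (S₀ \ V) := by
    intro hb
    exact (hmin.le_of_le ⟨hS₀.sdiff hV, hb⟩ Set.sdiff_subset ht₀).2 htV
  obtain ⟨g, hgB, hg1, r, hr0, hr1, hgr⟩ :=
    exists_norm_eq_one_of_not_isBoundaryFor B (hS₀.sdiff hV) hnb hK
  have hgle : ∀ t, ‖g t‖ ≤ 1 := fun t => hg1 ▸ g.norm_coe_le_norm t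
  have hm : ∃ m : ℕ, ∀ s ∈ I, r ^ m * ‖F s‖ < 1 := by
    have : ∀ᶠ m : ℕ in atTop, ∀ s ∈ I, r ^ m * ‖F s‖ < 1 := by
      rw [eventually_all_finset]
      intro s _
      have : Tendsto (fun m : ℕ => r ^ m * ‖F s‖) atTop (𝓝 (0 * ‖F s‖)) :=
        (tendsto_pow_atTop_nhds_zero_of_lt_one hr0 hr1).mul_const _
      rw [zero_mul] at this
      exact this.eventually_lt_const one_pos
    exact this.exists
  obtain ⟨m, hm⟩ := hm
  -- It suffices to bound on `S₀`: in `V` the factor `F s` is below 1, outside `V` the factor `g ^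
  -- m` is tiny. This contradicts `|g| = 1` at some point of `S`, where some `|F i| > 1`.
  have hlt : ∀ s ∈ I, ∀ t, ‖(g ^ m * F s) t‖ < 1 := by
    intro s hs
    obtain ⟨t₁, ht₁, h₁⟩ := hS₀B (g ^ m * F s) (B.mul_mem (B.pow_mem hgB m) (hFB s))
    refine fun t => ((g ^ m * F s).norm_coe_le_norm t).trans_lt ?_
    rw [← h₁, ContinuousMap.mul_apply, ContinuousMap.pow_apply, norm_mul, norm_pow]
    by_cases htV : t₁ ∈ V
    · have h1 : ‖F s t₁‖ < 1 := by
        simp only [V, Set.mem_iInter] at htV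
        exact htV s hs
      exact (mul_le_of_le_one_left (norm_nonneg _)
        (pow_le_one₀ (norm_nonneg _) (hgle t₁))).trans_lt h1
    · refine lt_of_le_of_lt ?_ (hm s hs)
      gcongr
      · exact hgr t₁ ⟨ht₁, htV⟩
      · exact (F s).norm_coe_le_norm t₁
  obtain ⟨s, hs, hgs⟩ := hSB g hgB
  obtain ⟨i, hi, his⟩ := Set.mem_iUnion₂.1 (hI hs)
  have := hlt i hi s
  rw [ContinuousMap.mul_apply, ContinuousMap.pow_apply, norm_mul, norm_pow, hgs, hg1, one_pow,
    one_mul] at this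
  exact absurd his (not_lt.2 this.le)

theorem isClosed_shilovBoundary (A : Set C(K, ℂ)) : IsClosed (shilovBoundary A) :=
  isClosed_sInter fun _ hS => hS.1

/-- Every open set meeting the Shilov boundary contains a point of it at which some norm-one
function of the algebra equals `1`, while being uniformly small on the rest of the boundary. -/
theorem exists_peak_shilovBoundary (B : Subalgebra ℂ C(K, ℂ))
    (hsep : B.SeparatesPoints) {O : Set K} (hO : IsOpen O)
    (hne : (O ∩ shilovBoundary (B : Set C(K, ℂ))).Nonempty) {η : ℝ} (hη : 0 < η) :
    ∃ f ∈ B, ‖f‖ ≤ 1 ∧ (∃ t ∈ O ∩ shilovBoundary (B : Set C(K, ℂ)), f t = 1) ∧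
      ∀ t ∈ shilovBoundary (B : Set C(K, ℂ)) \ O, ‖f t‖ ≤ η := by
  have hK : Nonempty K := ⟨hne.some⟩
  have hcl := (isClosed_shilovBoundary (B : Set C(K, ℂ))).sdiff hO
  have hnb : ¬ IsBoundaryFor (B : Set C(K, ℂ)) (shilovBoundary (B : Set C(K, ℂ)) \ O) := by
    intro hb
    obtain ⟨t, htO, ht⟩ := hne
    exact (ht _ ⟨hcl, hb⟩).2 htO
  obtain ⟨g, hgB, hg1, r, hr0, hr1, hgr⟩ :=
    exists_norm_eq_one_of_not_isBoundaryFor B hcl hnb hK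
  obtain ⟨t, ht, hgt⟩ := isBoundaryFor_shilovBoundary B hsep g hgB
  rw [hg1] at hgt
  have htO : t ∈ O := by
    by_contra h
    exact absurd (hgr t ⟨ht, h⟩) (by rw [hgt]; exact not_le.2 hr1)
  obtain ⟨m, hm⟩ := exists_pow_lt_of_lt_one hη hr1
  have hgt0 : g t ≠ 0 := norm_ne_zero_iff.1 (by rw [hgt]; exact one_ne_zero)
  have hinv : ‖(g t)⁻¹‖ = 1 := by rw [norm_inv, hgt, inv_one]
  refine ⟨((g t)⁻¹ • g) ^ m, B.pow_mem (B.smul_mem hgB _) m, ?_, ⟨t, ⟨htO, ht⟩, ?_⟩, fun s hs => ?_⟩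
  · refine (norm_pow_le _ m).trans ?_
    rw [norm_smul, hinv, hg1, one_mul, one_pow]
  · simp [hgt0]
  · rw [ContinuousMap.pow_apply, ContinuousMap.smul_apply, norm_pow, norm_smul, hinv, one_mul]
    exact (pow_le_pow_left₀ (norm_nonneg _) (hgr s hs) m).trans hm.le

/-- An isolated point of the Shilov boundary has an indicator function in the algebra. -/
theorem exists_indicator_of_isolated_shilovBoundary (B : Subalgebra ℂ C(K, ℂ))
    (hB : IsClosed (B : Set C(K, ℂ))) (hsep : B.SeparatesPoints) {t₀ : K} {O : Set K}
    (hO : IsOpen O) (h : O ∩ shilovBoundary (B : Set C(K, ℂ)) = {t₀}) :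
    ∃ e ∈ B, e t₀ = 1 ∧ ∀ t ∈ shilovBoundary (B : Set C(K, ℂ)), t ≠ t₀ → e t = 0 := by
  have hK : Nonempty K := ⟨t₀⟩
  obtain ⟨f, hfB, hf1, ⟨t, ht, hft⟩, hf⟩ :=
    exists_peak_shilovBoundary B hsep hO (h ▸ Set.singleton_nonempty t₀) (η := 1 / 2) (by norm_num)
  rw [h, Set.mem_singleton_iff] at ht
  subst ht
  have hf' : ∀ s ∈ shilovBoundary (B : Set C(K, ℂ)), s ≠ t → ‖f s‖ ≤ 1 / 2 := fun s hs hst =>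
    hf s ⟨hs, fun hsO => hst (h.subset ⟨hsO, hs⟩)⟩
  -- On the boundary `f ^ n - f ^ (n + 1)` vanishes at `t` and is at most `(1/2) ^ n * (3/2)`
  -- elsewhere; the boundary controls the norm, so the powers converge, to the indicator.
  have hcau : CauchySeq fun n : ℕ => f ^ n := by
    refine cauchySeq_of_le_geometric (1 / 2) 2 (by norm_num) fun n => ?_
    rw [dist_eq_norm]
    obtain ⟨s, hs, hs'⟩ := isBoundaryFor_shilovBoundary B hsep (f ^ n - f ^ (n + 1))
      (B.sub_mem (B.pow_mem hfB _) (B.pow_mem hfB _))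
    rw [← hs']
    by_cases hst : s = t
    · simp [hst, hft]
    · have h1 := hf' s hs hst
      have h2 : (f ^ n - f ^ (n + 1)) s = f s ^ n * (1 - f s) := by
        simp; ring
      rw [h2, norm_mul, norm_pow, mul_comm]
      gcongr
      refine (norm_sub_le _ _).trans ?_
      rw [norm_one]; linarith
  obtain ⟨e, he⟩ := cauchySeq_tendsto_of_complete hcau
  have hev : ∀ s, Tendsto (fun n : ℕ => f s ^ n) atTop (𝓝 (e s)) := fun s =>
    ((ContinuousEvalConst.continuous_eval_const s).tendsto e).comp he
  refine ⟨e, hB.mem_of_tendsto he (Eventually.of_forall fun n => B.pow_mem hfB n), ?_,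
    fun s hs hst => ?_⟩
  · refine tendsto_nhds_unique (hev t) ?_
    simp [hft]
  · refine tendsto_nhds_unique (hev s) (tendsto_pow_atTop_nhds_zero_of_norm_lt_one ?_)
    linarith [hf' s hs hst]

end ShilovBoundary

/-! ### Peaking functions with values near the unit interval -/

section LogPeak

/-- For `r` close to `1`, the function `z ↦ log (1 - r z) / log (1 - r)` maps the closed unit disc
into a small neighbourhood of the segment `[0, 1]`. -/
theorem exists_log_quotient_near_segment {δ : ℝ} (hδ : 0 < δ) :
    ∃ r : ℝ, 0 < r ∧ r < 1 ∧ ∀ z : ℂ, ‖z‖ ≤ 1 →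
      ‖Complex.log (1 - r * z) / Real.log (1 - r)‖ +
        ‖1 - Complex.log (1 - r * z) / Real.log (1 - r)‖ ≤ 1 + δ := by
  -- With `1 - r = exp (-L)` the logarithm has real part in `[-L, 1]` and imaginary part in `[-2,
  -- 2]`; dividing by `-L` leaves an excess of at most `12 / L`.
  set L : ℝ := 1 + 12 / δ with hL
  have hLpos : 0 < L := by positivity
  have hLδ : 12 / L ≤ δ := by
    rw [div_le_iff₀ hLpos, hL, mul_add, mul_div_cancel₀ _ hδ.ne']
    linarith
  refine ⟨1 - Real.exp (-L), ?_, by linarith [Real.exp_pos (-L)], fun z hz => ?_⟩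
  · have : Real.exp (-L) < 1 := by simpa using hLpos
    linarith
  set r : ℝ := 1 - Real.exp (-L) with hr
  have hr1 : 1 - r = Real.exp (-L) := by rw [hr]; ring
  have hr0 : 0 < r := by
    have : Real.exp (-L) < 1 := by simpa using hLpos
    rw [hr]; linarith
  have hrlt : r < 1 := by linarith [Real.exp_pos (-L)]
  rw [hr1, Real.log_exp]
  set l := Complex.log (1 - r * z) with hl
  have hrz : ‖(r : ℂ) * z‖ ≤ r := by
    rw [norm_mul, Complex.norm_real, Real.norm_of_nonneg hr0.le]
    exact mul_le_of_le_one_right hr0.le hz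
  have hre : 0 ≤ (1 - (r : ℂ) * z).re := by
    have := (Complex.re_le_norm ((r : ℂ) * z)).trans hrz
    rw [Complex.sub_re, Complex.one_re]; linarith
  have him : |l.im| ≤ 2 := by
    rw [hl, Complex.log_im]
    exact (Complex.abs_arg_le_pi_div_two_iff.2 hre).trans (by linarith [Real.pi_le_four])
  have hn1 : 1 - r ≤ ‖1 - (r : ℂ) * z‖ := by
    have := norm_sub_norm_le (1 : ℂ) ((r : ℂ) * z)
    rw [norm_one] at this; linarith
  have hn2 : ‖1 - (r : ℂ) * z‖ ≤ 2 := by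
    have := norm_sub_le (1 : ℂ) ((r : ℂ) * z)
    rw [norm_one] at this; linarith
  have hre1 : -L ≤ l.re := by
    rw [hl, Complex.log_re, ← Real.log_exp (-L), ← hr1]
    exact Real.log_le_log (by linarith) hn1
  have hre2 : l.re ≤ 1 := by
    rw [hl, Complex.log_re]
    have := Real.log_le_sub_one_of_pos (x := ‖1 - (r : ℂ) * z‖) (by linarith)
    linarith
  have e1 : l / ((-L : ℝ) : ℂ) = -(l / L) := by push_cast; rw [div_neg]
  have e2 : 1 - l / ((-L : ℝ) : ℂ) = (L + l) / L := by
    rw [e1]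
    have : (L : ℂ) ≠ 0 := by exact_mod_cast hLpos.ne'
    field_simp
    ring
  rw [e2, e1, norm_neg, norm_div, norm_div, Complex.norm_real, Real.norm_of_nonneg hLpos.le,
    ← add_div]
  have b1 : ‖l‖ ≤ |l.re| + |l.im| := Complex.norm_le_abs_re_add_abs_im l
  have b2 : ‖(L : ℂ) + l‖ ≤ (L + l.re) + |l.im| := by
    refine (Complex.norm_le_abs_re_add_abs_im _).trans ?_
    rw [Complex.add_re, Complex.add_im, Complex.ofReal_re, Complex.ofReal_im, zero_add,
      abs_of_nonneg (by linarith)]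
  have b3 : |l.re| ≤ 2 - l.re := abs_le.2 ⟨by linarith, by linarith⟩
  calc (‖l‖ + ‖(L : ℂ) + l‖) / L ≤ (L + 12) / L :=
        div_le_div_of_nonneg_right (by linarith) hLpos.le
    _ = 1 + 12 / L := by rw [add_div, div_self hLpos.ne']
    _ ≤ 1 + δ := by linarith

variable {K : Type*} [TopologicalSpace K] [CompactSpace K]

/-- A closed subalgebra of `C(K, ℂ)` contains `log (1 - f)` whenever it contains `f` and
`‖f‖ < 1`. -/
theorem exists_mem_eq_log_one_sub (B : Subalgebra ℂ C(K, ℂ)) (hB : IsClosed (B : Set C(K, ℂ)))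
    {f : C(K, ℂ)} (hf : f ∈ B) (hf1 : ‖f‖ < 1) :
    ∃ g ∈ B, ∀ t, g t = Complex.log (1 - f t) := by
  -- The term `n = 0` is zero, since `0⁻¹ = 0`, matching the Taylor series of `-log (1 - z)`.
  have hsum : Summable fun n : ℕ => ((n : ℂ)⁻¹) • f ^ n := by
    refine Summable.of_norm_bounded_eventually_nat (g := fun n => ‖f‖ ^ n)
      (summable_geometric_of_lt_one (norm_nonneg _) hf1) ?_
    filter_upwards [eventually_ge_atTop 1] with n hn
    rw [norm_smul, norm_inv, Complex.norm_natCast]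
    have h1 : ‖f ^ n‖ ≤ ‖f‖ ^ n := norm_pow_le' f hn
    have h2 : ((n : ℝ))⁻¹ ≤ 1 := inv_le_one_of_one_le₀ (by exact_mod_cast hn)
    exact (mul_le_of_le_one_left (norm_nonneg _) h2).trans h1
  obtain ⟨s, hs⟩ := hsum
  refine ⟨-s, B.neg_mem (hB.mem_of_tendsto hs (Eventually.of_forall fun I =>
    B.sum_mem fun n _ => B.smul_mem (B.pow_mem hf n) _)), fun t => ?_⟩
  have h1 : HasSum (fun n : ℕ => ((n : ℂ)⁻¹) • f t ^ n) (s t) := by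
    have := hs.map (ContinuousMap.evalCLM ℂ t : C(K, ℂ) →L[ℂ] ℂ)
      (ContinuousMap.evalCLM ℂ t : C(K, ℂ) →L[ℂ] ℂ).continuous
    simpa [Function.comp_def] using this
  have h2 := Complex.hasSum_taylorSeries_neg_log ((f.norm_coe_le_norm t).trans_lt hf1)
  have h3 := h1.unique (by simpa [div_eq_inv_mul] using h2)
  rw [ContinuousMap.neg_apply, h3, neg_neg]

/-- Peak functions of the algebra on the Shilov boundary, with values close to `[0, 1]`. -/
theorem exists_peak_near_segment_shilovBoundary (B : Subalgebra ℂ C(K, ℂ))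
    (hB : IsClosed (B : Set C(K, ℂ))) (hsep : B.SeparatesPoints) {O : Set K} (hO : IsOpen O)
    (hne : (O ∩ shilovBoundary (B : Set C(K, ℂ))).Nonempty) {δ : ℝ} (hδ : 0 < δ) :
    ∃ ψ ∈ B, (∀ t, ‖ψ t‖ + ‖1 - ψ t‖ ≤ 1 + δ) ∧
      (∃ t ∈ O ∩ shilovBoundary (B : Set C(K, ℂ)), ψ t = 1) ∧
      ∀ t ∈ shilovBoundary (B : Set C(K, ℂ)) \ O, ‖ψ t‖ ≤ δ := by
  obtain ⟨r, hr0, hr1, hr⟩ := exists_log_quotient_near_segment hδ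
  set L := Real.log (1 - r) with hL
  have hLneg : L < 0 := Real.log_neg (by linarith) (by linarith)
  have hLpos : 0 < -L := by linarith
  -- The bound `1/2` allows `|log (1 + z)| ≤ (3/2) |z|`; the other bound absorbs the division by
  -- `L`.
  obtain ⟨f, hfB, hf1, ⟨t₀, ht₀, hft₀⟩, hf⟩ := exists_peak_shilovBoundary B hsep hO hne
    (η := min (1 / 2) (δ * -L / 2)) (by positivity)
  have hnorm : ‖(r : ℂ) • f‖ < 1 := by
    rw [norm_smul, Complex.norm_real, Real.norm_of_nonneg hr0.le]
    exact (mul_le_of_le_one_right hr0.le hf1).trans_lt hr1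
  obtain ⟨g, hgB, hg⟩ := exists_mem_eq_log_one_sub B hB (B.smul_mem hfB (r : ℂ)) hnorm
  have hval : ∀ t, ((L : ℂ)⁻¹ • g) t = Complex.log (1 - r * f t) / L := fun t => by
    rw [ContinuousMap.smul_apply, hg, smul_eq_mul, div_eq_inv_mul]; rfl
  refine ⟨(L : ℂ)⁻¹ • g, B.smul_mem hgB _, fun t => ?_, ⟨t₀, ht₀, ?_⟩, fun t ht => ?_⟩
  · rw [hval]
    exact hr _ ((f.norm_coe_le_norm t).trans hf1)
  · rw [hval, hft₀, mul_one]
    have : Complex.log (1 - (r : ℂ)) = (L : ℂ) := by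
      rw [hL, Complex.ofReal_log (by linarith)]; push_cast; rfl
    rw [this, div_self]
    exact_mod_cast hLneg.ne
  · have h1 := hf t ht
    have h2 : ‖-((r : ℂ) * f t)‖ ≤ ‖f t‖ := by
      rw [norm_neg, norm_mul, Complex.norm_real, Real.norm_of_nonneg hr0.le]
      exact mul_le_of_le_one_left (norm_nonneg _) hr1.le
    have h3 := Complex.norm_log_one_add_half_le_self
      (h2.trans (h1.trans (min_le_left _ _)))
    have h4 := h1.trans (min_le_right _ _)
    rw [hval, norm_div, Complex.norm_real, Real.norm_of_nonpos hLneg.le, div_le_iff₀ hLpos,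
      sub_eq_add_neg]
    have h5 := mul_pos hδ hLpos
    linarith

end LogPeak

/-- An open set meeting a preperfect set `S` contains a sequence of open sets meeting `S` whose
traces on `S` are pairwise disjoint. -/
theorem Preperfect.exists_seq_isOpen_disjoint {K : Type*} [TopologicalSpace K] [T2Space K] {S W : Set K} (hS : Preperfect S)
    (hW : IsOpen W) (hne : (W ∩ S).Nonempty) :
    ∃ O : ℕ → Set K, (∀ n, IsOpen (O n)) ∧ (∀ n, O n ⊆ W) ∧ (∀ n, (O n ∩ S).Nonempty) ∧
      ∀ t ∈ S, ∀ m n, t ∈ O m → t ∈ O n → m = n := by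
  -- A finite trace could be punctured by an open set, isolating `x`.
  have hinf : (W ∩ S).Infinite := by
    obtain ⟨x, hx⟩ := hne
    have h1 : AccPt x (𝓟 (W ∩ S)) := hS.open_inter hW x hx
    intro hfin
    have h2 := accPt_iff_nhds.1 h1 ((W ∩ S) \ {x})ᶜ
      ((hfin.subset Set.sdiff_subset).isClosed.isOpen_compl.mem_nhds (by simp))
    obtain ⟨y, ⟨hy1, hy2⟩, hyx⟩ := h2
    exact (Set.mem_compl_iff _ _).1 hy1 ⟨hy2, hyx⟩
  have : Infinite ↑(W ∩ S) := hinf.to_subtype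
  obtain ⟨U, hUinf, hUo, hUd⟩ := exists_seq_infinite_isOpen_pairwise_disjoint ↑(W ∩ S)
  choose O hO hOU using fun n => isOpen_induced_iff.1 (hUo n)
  refine ⟨fun n => O n ∩ W, fun n => (hO n).inter hW, fun n => Set.inter_subset_right,
    fun n => ?_, fun t ht m n hm hn => ?_⟩
  · obtain ⟨x, hx⟩ := (hUinf n).nonempty
    rw [← hOU] at hx
    exact ⟨x, ⟨hx, x.2.1⟩, x.2.2⟩
  · by_contra hmn
    have hU : ∀ i, t ∈ O i → (⟨t, hm.2, ht⟩ : ↑(W ∩ S)) ∈ U i := fun i hi => by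
      rw [← hOU]; exact hi
    exact Set.disjoint_left.1 (hUd hmn) (hU m hm.1) (hU n hn.1)

/-! ### Norms on the boundary and weakly null sequences in `M` -/

section FunctionSpace

variable {K : Type*} [TopologicalSpace K]
variable {X : Type*} [NormedAddCommGroup X] [NormedSpace ℂ X]

/-- The base algebra as a closed separating subalgebra. -/
theorem IsFunctionSpaceOverUniformAlgebra.exists_subalgebra {M : Submodule ℂ C(K, X)}
    (hM : IsFunctionSpaceOverUniformAlgebra M) :
    ∃ B : Subalgebra ℂ C(K, ℂ), (B : Set C(K, ℂ)) = baseAlgebra M ∧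
      IsClosed (B : Set C(K, ℂ)) ∧ B.SeparatesPoints := by
  obtain ⟨B, hB, hcl, hsep⟩ := hM.isUniformAlgebra_base
  exact ⟨B, hB, hB ▸ hcl, hsep⟩

/-- The product of a function of the base algebra and an element of `M`. -/
noncomputable def baseMul {M : Submodule ℂ C(K, X)} (hM : IsFunctionSpaceOverUniformAlgebra M)
    (φ : baseAlgebra M) (f : M) : M :=
  ⟨φ.1 • f.1, hM.smul_mem φ.1 φ.2 f.1 f.2⟩

theorem baseMul_apply {M : Submodule ℂ C(K, X)} (hM : IsFunctionSpaceOverUniformAlgebra M)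
    (φ : baseAlgebra M) (f : M) (t : K) : (baseMul hM φ f).1 t = φ.1 t • f.1 t := by
  simp [baseMul]

variable [CompactSpace K]

theorem nonempty_of_norm_eq_one {M : Submodule ℂ C(K, X)} {f : M} (hf : ‖f‖ = 1) :
    Nonempty K := by
  by_contra h
  rw [not_nonempty_iff] at h
  have : f = 0 := Subtype.ext (ContinuousMap.ext fun t => h.elim t)
  rw [this, norm_zero] at hf
  exact zero_ne_one hf

/-- The functions of `M` attain their norm on the Shilov boundary of the base algebra. -/
theorem exists_norm_eq_of_mem_shilovBoundary {M : Submodule ℂ C(K, X)}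
    (hM : IsFunctionSpaceOverUniformAlgebra M) [Nonempty K] {f : C(K, X)} (hf : f ∈ M) :
    ∃ t ∈ shilovBoundary (baseAlgebra M), ‖f t‖ = ‖f‖ := by
  obtain ⟨B, hB, -, hsep⟩ := hM.exists_subalgebra
  obtain ⟨s, -, hs⟩ := isCompact_univ.exists_isMaxOn (Set.univ_nonempty (α := K))
    (f := fun t => ‖f t‖) (by fun_prop)
  have hs' : ‖f s‖ = ‖f‖ := le_antisymm (f.norm_coe_le_norm s)
    ((f.norm_le (norm_nonneg _)).2 fun t => hs (Set.mem_univ t))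
  obtain ⟨y, hy1, hy⟩ := exists_dual_vector'' ℂ (f s)
  let φ : C(K, ℂ) := ⟨fun t => y (f t), by fun_prop⟩
  have hφ : φ ∈ B := by
    rw [← SetLike.mem_coe, hB]
    exact ⟨f, hf, y, fun _ => rfl⟩
  obtain ⟨t, ht, ht'⟩ := isBoundaryFor_shilovBoundary B hsep φ hφ
  rw [hB] at ht
  refine ⟨t, ht, le_antisymm (f.norm_coe_le_norm t) ?_⟩
  calc ‖f‖ = ‖φ s‖ := by
        simp only [φ, ContinuousMap.coe_mk, hy]
        exact (hs'.symm.trans (norm_norm _).symm).trans (Complex.norm_real _).symm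
    _ ≤ ‖φ‖ := φ.norm_coe_le_norm s
    _ = ‖y (f t)‖ := ht'.symm
    _ ≤ 1 * ‖f t‖ := y.le_of_opNorm_le hy1 _
    _ = ‖f t‖ := one_mul _

/-- A sequence in the base algebra which is uniformly small off pairwise disjoint sets
of the Shilov boundary multiplies bounded sequences of `M` to weakly null sequences. -/
theorem tendsto_apply_baseMul_of_pairwise_disjoint {M : Submodule ℂ C(K, X)}
    (hM : IsFunctionSpaceOverUniformAlgebra M) {ψ : ℕ → baseAlgebra M} {O : ℕ → Set K}
    (hO : ∀ t ∈ shilovBoundary (baseAlgebra M), ∀ m n, t ∈ O m → t ∈ O n → m = n)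
    (hψ2 : ∀ n t, ‖(ψ n).1 t‖ ≤ 2)
    (hψ : ∀ n, ∀ t ∈ shilovBoundary (baseAlgebra M) \ O n, ‖(ψ n).1 t‖ ≤ (1 / 2) ^ n)
    {k : ℕ → M} {C : ℝ} (hk : ∀ n, ‖k n‖ ≤ C) (F : StrongDual ℂ M) :
    Tendsto (fun n => F (baseMul hM (ψ n) (k n))) atTop (𝓝 0) := by
  rcases isEmpty_or_nonempty K with hK | hK
  · have : ∀ f : M, f = 0 := fun f => Subtype.ext (ContinuousMap.ext fun t => hK.elim t)
    simp [this (baseMul hM _ _)]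
  have hC : 0 ≤ C := (norm_nonneg _).trans (hk 0)
  -- Each `t` lies in at most one `O n`, which contributes at most 2; the geometric tails contribute
  -- at most 2 more.
  have hsumψ : ∀ t ∈ shilovBoundary (baseAlgebra M), ∀ N,
      ∑ n ∈ Finset.range N, ‖(ψ n).1 t‖ ≤ 4 := by
    intro t ht N
    have h1 : ∀ n, ‖(ψ n).1 t‖ ≤ (1 / 2) ^ n + (O n).indicator (fun _ => (2 : ℝ)) t := by
      intro n
      by_cases h : t ∈ O n
      · rw [Set.indicator_of_mem h]
        have : (0 : ℝ) ≤ (1 / 2) ^ n := by positivity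
        linarith [hψ2 n t]
      · rw [Set.indicator_of_notMem h, add_zero]
        exact hψ n t ⟨ht, h⟩
    have h2 : ∑ n ∈ Finset.range N, (O n).indicator (fun _ => (2 : ℝ)) t ≤ 2 := by
      by_cases h : ∃ m, t ∈ O m
      · obtain ⟨m, hm⟩ := h
        calc ∑ n ∈ Finset.range N, (O n).indicator (fun _ => (2 : ℝ)) t
            ≤ ∑ n ∈ Finset.range N, if n = m then 2 else 0 := by
              refine Finset.sum_le_sum fun n _ => ?_
              by_cases hn : t ∈ O n
              · rw [Set.indicator_of_mem hn, if_pos (hO t ht _ _ hn hm)]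
              · rw [Set.indicator_of_notMem hn]
                split_ifs <;> norm_num
          _ ≤ 2 := by
              rw [Finset.sum_ite_eq']
              split_ifs <;> norm_num
      · push Not at h
        simp [Set.indicator_of_notMem (h _)]
    have h3 : ∑ n ∈ Finset.range N, (1 / 2 : ℝ) ^ n ≤ 2 := sum_geometric_two_le N
    calc ∑ n ∈ Finset.range N, ‖(ψ n).1 t‖
        ≤ ∑ n ∈ Finset.range N, ((1 / 2) ^ n + (O n).indicator (fun _ => (2 : ℝ)) t) :=
          Finset.sum_le_sum fun n _ => h1 n
      _ ≤ 4 := by rw [Finset.sum_add_distrib]; linarith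
  -- Unimodular (or zero) coefficients turn `∑ ‖F (·)‖` into `F v` with `‖v‖ ≤ 4 * C`, so the series
  -- converges absolutely.
  have hbound : ∀ N, ∑ n ∈ Finset.range N, ‖F (baseMul hM (ψ n) (k n))‖ ≤ ‖F‖ * (4 * C) := by
    intro N
    have hc : ∀ z : ℂ, ∃ c : ℂ, ‖c‖ ≤ 1 ∧ c * z = ‖z‖ := by
      intro z
      rcases eq_or_ne z 0 with rfl | hz
      · exact ⟨0, by simp, by simp⟩
      · refine ⟨‖z‖ / z, ?_, div_mul_cancel₀ _ hz⟩
        rw [norm_div, Complex.norm_real, norm_norm, div_self (norm_ne_zero_iff.2 hz)]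
    choose c hc1 hc using hc
    let v : M := ∑ n ∈ Finset.range N,
      c (F (baseMul hM (ψ n) (k n))) • baseMul hM (ψ n) (k n)
    have hFv : F v = ((∑ n ∈ Finset.range N, ‖F (baseMul hM (ψ n) (k n))‖ : ℝ) : ℂ) := by
      simp only [v, map_sum, map_smul, smul_eq_mul, hc, Complex.ofReal_sum]
    have hv : ‖v‖ ≤ 4 * C := by
      obtain ⟨t, ht, hvt⟩ := exists_norm_eq_of_mem_shilovBoundary hM v.2
      change ‖v.1‖ ≤ _
      rw [← hvt]
      have hval : v.1 t = ∑ n ∈ Finset.range N,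
          c (F (baseMul hM (ψ n) (k n))) • (ψ n).1 t • (k n).1 t := by
        simp only [v, AddSubmonoidClass.coe_finsetSum, ContinuousMap.sum_apply,
          SetLike.val_smul, ContinuousMap.smul_apply, baseMul_apply]
      rw [hval]
      calc ‖∑ n ∈ Finset.range N, c (F (baseMul hM (ψ n) (k n))) • (ψ n).1 t • (k n).1 t‖
          ≤ ∑ n ∈ Finset.range N, ‖(ψ n).1 t‖ * C := by
            refine norm_sum_le_of_le _ fun n _ => ?_
            rw [norm_smul, norm_smul]
            have h1 : ‖(k n).1 t‖ ≤ C := ((k n).1.norm_coe_le_norm t).trans (hk n)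
            calc _ ≤ 1 * (‖(ψ n).1 t‖ * C) := by
                  gcongr
                  exact hc1 _
              _ = _ := one_mul _
        _ ≤ 4 * C := by
            rw [← Finset.sum_mul]
            gcongr
            exact hsumψ t ht N
    have h1 : ‖F v‖ ≤ ‖F‖ * (4 * C) := (F.le_opNorm v).trans (by gcongr)
    rw [hFv, Complex.norm_real] at h1
    exact (le_abs_self _).trans h1
  exact tendsto_zero_iff_norm_tendsto_zero.2
    (summable_of_sum_range_le (fun _ => norm_nonneg _) hbound).tendsto_atTop_zero

/-- If the Shilov boundary has no isolated point, there is a sequence in the base algebra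
peaking at points where a given norm-one function `g` is almost of norm one, with values close
to `[0, 1]`, and multiplying bounded sequences to weakly null sequences. -/
theorem exists_seq_peak_weakly_null [T2Space K] {M : Submodule ℂ C(K, X)}
    (hM : IsFunctionSpaceOverUniformAlgebra M)
    (hΓ : Preperfect (shilovBoundary (baseAlgebra M))) {g : M} (hg : ‖g‖ = 1) {ε : ℝ}
    (hε : 0 < ε) :
    ∃ (ψ : ℕ → baseAlgebra M) (p : ℕ → K), (∀ n, (ψ n).1 (p n) = 1) ∧
      (∀ n, 1 - ε < ‖g.1 (p n)‖) ∧
      (∀ n t, ‖(ψ n).1 t‖ + ‖1 - (ψ n).1 t‖ ≤ 1 + (1 / 2) ^ n) ∧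
      ∀ (k : ℕ → M) (C : ℝ), (∀ n, ‖k n‖ ≤ C) → ∀ F : StrongDual ℂ M,
        Tendsto (fun n => F (baseMul hM (ψ n) (k n))) atTop (𝓝 0) := by
  have hK := nonempty_of_norm_eq_one hg
  obtain ⟨B, hB, hcl, hsep⟩ := hM.exists_subalgebra
  obtain ⟨s, hs, hgs⟩ := exists_norm_eq_of_mem_shilovBoundary hM g.2
  have hgs' : ‖g.1 s‖ = 1 := hgs.trans hg
  have hW : IsOpen {t : K | 1 - ε < ‖g.1 t‖} := isOpen_lt continuous_const (by fun_prop)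
  obtain ⟨O, hO, hOW, hOne, hOd⟩ := hΓ.exists_seq_isOpen_disjoint hW
    ⟨s, by simpa [hgs'] using hε, hs⟩
  rw [← hB] at hOne
  have hpeak : ∀ n : ℕ, ∃ (ψ : C(K, ℂ)) (p : K), ψ ∈ B ∧
      (∀ t, ‖ψ t‖ + ‖1 - ψ t‖ ≤ 1 + (1 / 2) ^ n) ∧ p ∈ O n ∧ ψ p = 1 ∧
      ∀ t ∈ shilovBoundary (B : Set C(K, ℂ)) \ O n, ‖ψ t‖ ≤ (1 / 2) ^ n := by
    intro n
    obtain ⟨ψ, h1, h2, ⟨p, h3, h4⟩, h5⟩ := exists_peak_near_segment_shilovBoundary B hcl hsep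
      (hO n) (hOne n) (δ := (1 / 2) ^ n) (by positivity)
    exact ⟨ψ, p, h1, h2, h3.1, h4, h5⟩
  choose ψ p hψB hψ hp hψp hψO using hpeak
  have hmem : ∀ n, ψ n ∈ baseAlgebra M := fun n => hB ▸ hψB n
  rw [hB] at hψO
  refine ⟨fun n => ⟨ψ n, hmem n⟩, p, hψp, fun n => hOW n (hp n), hψ, fun k C hk F => ?_⟩
  refine tendsto_apply_baseMul_of_pairwise_disjoint hM hOd (fun n t => ?_) hψO hk F
  have h1 := hψ n t
  have h2 : (1 / 2 : ℝ) ^ n ≤ 1 := pow_le_one₀ (by norm_num) (by norm_num)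
  have h3 := norm_nonneg (1 - ψ n t)
  change ‖ψ n t‖ ≤ 2
  linarith

end FunctionSpace

/-! ### Relations between the Daugavet and diametral properties -/

section DiameterTwoProperties

variable {E : Type*} [NormedAddCommGroup E] [NormedSpace ℂ E]

/-- Sequential weak convergence tested on the dual. -/
theorem tendsto_toWeakSpace {h : ℕ → E} {x : E}
    (hh : ∀ F : StrongDual ℂ E, Tendsto (fun n => F (h n)) atTop (𝓝 (F x))) :
    Tendsto (fun n => toWeakSpace ℂ E (h n)) atTop (𝓝 (toWeakSpace ℂ E x)) := by
  refine (WeakBilin.tendsto_iff_forall_eval_tendsto (topDualPairing ℂ E).flip ?_).2 hh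
  intro x y hxy
  refine (SeparatingDual.eq_iff_forall_dual_eq (R := ℂ)).2 fun F => ?_
  exact congrArg (fun G => G F) hxy

theorem HasDD2P.hasDLD2P (h : HasDD2P E) : HasDLD2P E := by
  intro φ _ α _ x hx hx1 ε hε
  have hV : IsOpen {z : WeakSpace ℂ E | 1 - α < (φ ((toWeakSpace ℂ E).symm z)).re} := by
    refine isOpen_lt continuous_const (Complex.continuous_re.comp ?_)
    exact WeakBilin.eval_continuous (topDualPairing ℂ E).flip φ
  obtain ⟨y, hy, hxy⟩ := h _ hV _ rfl x ⟨by simpa using hx.1, by simpa using hx.2⟩ hx1 ε hε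
  exact ⟨y, ⟨by simpa using hy.1, by simpa using hy.2⟩, hxy⟩

/-- The operator `-φ ⊗ x` has norm 1, so `‖y - φ(y) x‖` is almost 2 for some `y` in the ball. This
forces `|φ y|` to be almost 1, and a rotation of `y` lands in the slice, far from `x`. -/
theorem HasDaugavetProperty.hasDLD2P (h : HasDaugavetProperty E) : HasDLD2P E := by
  intro φ hφ α hα x hx hx1 ε hε
  have hφ0 : φ ≠ 0 := by rintro rfl; simp at hφ
  have hx0 : x ≠ 0 := by rintro rfl; simp at hx1
  have hfin : Module.finrank ℂ
      (LinearMap.range ((φ.smulRight (-x) : E →L[ℂ] E) : E →ₗ[ℂ] E)) = 1 := by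
    have : ((φ.smulRight (-x) : E →L[ℂ] E) : E →ₗ[ℂ] E) =
        (φ : E →ₗ[ℂ] ℂ).smulRight (-x) := rfl
    rw [this, LinearMap.range_smulRight_apply (by exact_mod_cast hφ0)]
    exact finrank_span_singleton (neg_ne_zero.2 hx0)
  have hT := h _ hfin
  rw [ContinuousLinearMap.norm_smulRight_apply, norm_neg, hφ, hx1] at hT
  set η := min (α / 2) (ε / 2) with hη
  have hη0 : 0 < η := by positivity
  obtain ⟨y, hy1, hy⟩ := ContinuousLinearMap.exists_lt_apply_of_lt_opNorm
    (ContinuousLinearMap.id ℂ E + φ.smulRight (-x)) (r := 2 - η) (by linarith)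
  obtain ⟨c, hc1, hc⟩ : ∃ c : ℂ, ‖c‖ = 1 ∧ c * φ y = ‖φ y‖ := by
    rcases eq_or_ne (φ y) 0 with h0 | h0
    · exact ⟨1, norm_one, by simp [h0]⟩
    · refine ⟨‖φ y‖ / φ y, ?_, div_mul_cancel₀ _ h0⟩
      rw [norm_div, Complex.norm_real, norm_norm, div_self (norm_ne_zero_iff.2 h0)]
  set ρ := ‖φ y‖ with hρ
  have hz1 : ‖c • y‖ ≤ 1 := by rw [norm_smul, hc1, one_mul]; exact hy1.le
  have hρ1 : ρ ≤ 1 := (φ.le_of_opNorm_le hφ.le y).trans (by linarith)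
  have hz : 2 - η < ‖c • y - (ρ : ℂ) • x‖ := by
    have : c • y - (ρ : ℂ) • x =
        c • (ContinuousLinearMap.id ℂ E + φ.smulRight (-x)) y := by
      simp [smul_add, smul_smul, hc, sub_eq_add_neg]
    rw [this, norm_smul, hc1, one_mul]
    exact hy
  have hρx : ‖(ρ : ℂ) • x‖ = ρ := by
    rw [norm_smul, Complex.norm_real, norm_norm, hx1, mul_one]
  have hρη : 1 - η < ρ := by
    have := norm_sub_le (c • y) ((ρ : ℂ) • x)
    linarith
  refine ⟨c • y, ⟨hz1, ?_⟩, ?_⟩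
  · rw [map_smul, smul_eq_mul, hc, Complex.ofReal_re]
    linarith [min_le_left (α / 2) (ε / 2)]
  · have h1 : ‖x - (ρ : ℂ) • x‖ = 1 - ρ := by
      have : x - (ρ : ℂ) • x = ((1 - ρ : ℝ) : ℂ) • x := by
        push_cast; rw [sub_smul, one_smul]
      rw [this, norm_smul, Complex.norm_real, Real.norm_of_nonneg (by linarith), hx1, mul_one]
    have h2 : ‖c • y - (ρ : ℂ) • x‖ ≤ ‖x - c • y‖ + ‖x - (ρ : ℂ) • x‖ := by
      rw [norm_sub_rev x (c • y)]
      exact norm_sub_le_norm_sub_add_norm_sub _ _ _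
    linarith [min_le_right (α / 2) (ε / 2)]

/-- The slice criterion for the Daugavet property. -/
theorem hasDaugavetProperty_of_slices
    (h : ∀ φ : StrongDual ℂ E, ‖φ‖ = 1 → ∀ g : E, ‖g‖ = 1 → ∀ α : ℝ, 0 < α →
      ∃ y ∈ ballSlice φ α, 2 - α ≤ ‖y + g‖) : HasDaugavetProperty E := by
  intro T hT
  obtain ⟨v, hv0, hv⟩ := finrank_eq_one_iff'.1 hT
  have hv0' : (v : E) ≠ 0 := fun h => hv0 (Subtype.ext h)
  obtain ⟨u, hu1, hu⟩ := exists_dual_vector ℂ (v : E) (norm_ne_zero_iff.2 hv0')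
  have hvn : (0 : ℝ) < ‖(v : E)‖ := norm_pos_iff.2 hv0'
  set g : E := ((‖(v : E)‖ : ℂ)⁻¹) • (v : E) with hg
  have hg1 : ‖g‖ = 1 := by
    rw [hg, norm_smul, norm_inv, Complex.norm_real, norm_norm, inv_mul_cancel₀ hvn.ne']
  set F : StrongDual ℂ E := u.comp T with hF
  have hvc : ((‖(v : E)‖ : ℝ) : ℂ) ≠ 0 := by exact_mod_cast hvn.ne'
  have hTF : T = F.smulRight g := by
    ext x
    obtain ⟨c, hc⟩ := hv ⟨T x, LinearMap.mem_range_self _ x⟩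
    have hc' : T x = c • (v : E) := (congrArg Subtype.val hc).symm
    have hu' : u (v : E) = ((‖(v : E)‖ : ℝ) : ℂ) := hu
    rw [ContinuousLinearMap.smulRight_apply, hF,
      ContinuousLinearMap.comp_apply, hc', map_smul, hu', hg, smul_smul, smul_eq_mul,
      mul_inv_cancel_right₀ hvc]
  have hTn : ‖T‖ = ‖F‖ := by
    rw [hTF, ContinuousLinearMap.norm_smulRight_apply, hg1, mul_one]
  have hFne : F ≠ 0 := by
    intro h0
    obtain ⟨x, hx⟩ := v.2
    apply hv0'
    rw [← hx, hTF, h0]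
    simp
  have hF0 : 0 < ‖F‖ := norm_pos_iff.2 hFne
  have hFc : ((‖F‖ : ℝ) : ℂ) ≠ 0 := by exact_mod_cast hF0.ne'
  set a := ‖F‖ with ha
  set φ : StrongDual ℂ E := (a : ℂ)⁻¹ • F with hφ
  have hφ1 : ‖φ‖ = 1 := by
    rw [hφ, norm_smul, norm_inv, Complex.norm_real, ha, norm_norm, inv_mul_cancel₀ hF0.ne']
  have hFφ : ∀ x, F x = a * φ x := fun x => by
    rw [hφ, smul_apply, smul_eq_mul, mul_inv_cancel_left₀ hFc]
  refine le_antisymm ((norm_add_le _ _).trans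
    (add_le_add ContinuousLinearMap.norm_id_le le_rfl)) ?_
  rw [hTn]
  refine le_of_forall_pos_le_add fun ε hε => ?_
  -- A slice of depth `β ^ 2 / 2` forces `|φ y - 1| ≤ β`. The losses `(1 + a) * β` in `hsum` and `a
  -- * β` in `h3` then total at most `ε`.
  set β := min 1 (ε / (1 + 2 * a)) with hβ
  have hβ0 : 0 < β := by positivity
  have hβ1 : β ≤ 1 := min_le_left _ _
  have hβε : (1 + 2 * a) * β ≤ ε := by
    have := min_le_right 1 (ε / (1 + 2 * a))
    rwa [← hβ, le_div_iff₀ (by positivity), mul_comm] at this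
  obtain ⟨y, ⟨hy1, hyφ⟩, hyg⟩ := h φ hφ1 g hg1 (β ^ 2 / 2) (by positivity)
  have hφy : ‖φ y‖ ≤ 1 := (φ.le_of_opNorm_le hφ1.le y).trans (by linarith)
  have hdist : ‖φ y - 1‖ ≤ β := by
    refine abs_le_of_sq_le_sq' ?_ hβ0.le |>.2
    have h1 : ‖φ y‖ ^ 2 ≤ 1 := pow_le_one₀ (norm_nonneg _) hφy
    rw [← Complex.normSq_eq_norm_sq, Complex.normSq_apply] at h1 ⊢
    simp only [Complex.sub_re, Complex.sub_im, Complex.one_re, Complex.one_im]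
    nlinarith
  have hαβ : β ^ 2 / 2 ≤ β := by nlinarith
  have hsum : 1 + a - (1 + a) * β ≤ ‖y + (a : ℂ) • g‖ := by
    -- Near-additivity of the norm for `y`, `g` passes to `y`, `a g`: the larger multiple is reduced
    -- and the difference paid by the triangle inequality.
    rcases le_total a 1 with ha1 | ha1
    · have e : y + g = (y + (a : ℂ) • g) + ((1 - a : ℝ) : ℂ) • g := by
        push_cast; rw [sub_smul, one_smul]; abel
      have h1 := norm_add_le (y + (a : ℂ) • g) (((1 - a : ℝ) : ℂ) • g)
      rw [← e, norm_smul, Complex.norm_real, Real.norm_of_nonneg (by linarith), hg1] at h1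
      nlinarith
    · have e : (a : ℂ) • (y + g) = (y + (a : ℂ) • g) + ((a - 1 : ℝ) : ℂ) • y := by
        push_cast; rw [sub_smul, one_smul, smul_add]; abel
      have h1 := norm_add_le (y + (a : ℂ) • g) (((a - 1 : ℝ) : ℂ) • y)
      rw [← e, norm_smul, norm_smul, Complex.norm_real, Complex.norm_real,
        Real.norm_of_nonneg hF0.le, Real.norm_of_nonneg (by linarith)] at h1
      have h2 : (a - 1) * ‖y‖ ≤ (a - 1) * 1 := by gcongr
      have h3 : a * (2 - β) ≤ a * ‖y + g‖ := by gcongr; linarith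
      linarith
  have hTy : (ContinuousLinearMap.id ℂ E + T) y =
      (y + (a : ℂ) • g) + (a * (φ y - 1)) • g := by
    rw [hTF, add_apply, ContinuousLinearMap.id_apply,
      ContinuousLinearMap.smulRight_apply, hFφ, mul_sub, mul_one, sub_smul]
    abel
  have h1 := (ContinuousLinearMap.id ℂ E + T).le_of_opNorm_le le_rfl y
  have h2 : ‖(ContinuousLinearMap.id ℂ E + T)‖ * ‖y‖ ≤ ‖(ContinuousLinearMap.id ℂ E + T)‖ :=
    mul_le_of_le_one_right (norm_nonneg _) hy1
  have h3 : ‖((a : ℂ) * (φ y - 1)) • g‖ ≤ a * β := by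
    rw [norm_smul, hg1, mul_one, norm_mul, Complex.norm_real, Real.norm_of_nonneg hF0.le]
    gcongr
  have h4 := norm_sub_le ((y + (a : ℂ) • g) + ((a : ℂ) * (φ y - 1)) • g)
    (((a : ℂ) * (φ y - 1)) • g)
  rw [add_sub_cancel_right, ← hTy] at h4
  linarith

end DiameterTwoProperties

/-! ### The implications between the four properties -/

section MainTheorem

variable {K : Type*} [TopologicalSpace K] [CompactSpace K]
variable {X : Type*} [NormedAddCommGroup X] [NormedSpace ℂ X]

theorem preperfect_shilovBoundary_of_hasDLD2P [UniformConvexSpace X]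
    {M : Submodule ℂ C(K, X)} (hM : IsFunctionSpaceOverUniformAlgebra M) (h : HasDLD2P M) :
    Preperfect (shilovBoundary (baseAlgebra M)) := by
  intro t₀ ht₀
  by_contra hacc
  have hK : Nonempty K := ⟨t₀⟩
  rw [accPt_iff_nhds] at hacc
  push Not at hacc
  obtain ⟨U, hU, hUt⟩ := hacc
  obtain ⟨O, hOU, hO, ht₀O⟩ := mem_nhds_iff.1 hU
  have hOΓ : O ∩ shilovBoundary (baseAlgebra M) = {t₀} :=
    Set.Subset.antisymm (fun t ht => hUt t ⟨hOU ht.1, ht.2⟩)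
      (Set.singleton_subset_iff.2 ⟨ht₀O, ht₀⟩)
  obtain ⟨B, hB, hcl, hsep⟩ := hM.exists_subalgebra
  obtain ⟨e, heB, he1, he0⟩ :=
    exists_indicator_of_isolated_shilovBoundary B hcl hsep hO (by rw [hB]; exact hOΓ)
  rw [hB] at he0
  have heA : e ∈ baseAlgebra M := hB ▸ heB
  have h1A : (1 : C(K, ℂ)) ∈ baseAlgebra M := hB ▸ B.one_mem
  -- Writing the constant 1 as `y ∘ f` provides an `f` in `M` that does not vanish at `t₀`.
  obtain ⟨f, hfM, y, hy⟩ := h1A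
  have hf0 : f t₀ ≠ 0 := by
    intro h0
    have := hy t₀
    rw [h0, map_zero] at this
    exact one_ne_zero this
  have hfn : 0 < ‖f t₀‖ := norm_pos_iff.2 hf0
  let g : M := ((‖f t₀‖ : ℂ)⁻¹) • ⟨e • f, hM.smul_mem e heA f hfM⟩
  have hgval : ∀ t, g.1 t = ((‖f t₀‖ : ℂ)⁻¹) • e t • f t := fun t => by
    simp [g]
  have hgt₀ : ‖g.1 t₀‖ = 1 := by
    rw [hgval, he1, one_smul, norm_smul, norm_inv, Complex.norm_real, norm_norm,
      inv_mul_cancel₀ hfn.ne']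
  have hg0 : ∀ t ∈ shilovBoundary (baseAlgebra M), t ≠ t₀ → g.1 t = 0 := fun t ht htt => by
    rw [hgval, he0 t ht htt, zero_smul, smul_zero]
  have hg1 : ‖g‖ = 1 := by
    have h1 : 1 ≤ ‖g.1‖ := hgt₀ ▸ g.1.norm_coe_le_norm t₀
    obtain ⟨t, ht, hgt⟩ := exists_norm_eq_of_mem_shilovBoundary hM g.2
    rcases eq_or_ne t t₀ with rfl | htt
    · exact hgt.symm.trans hgt₀
    · rw [hg0 t ht htt, norm_zero] at hgt
      linarith
  obtain ⟨u, hu1, hu⟩ := exists_dual_vector ℂ (g.1 t₀) (by rw [hgt₀]; exact one_ne_zero)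
  have hu' : u (g.1 t₀) = 1 := by
    rw [hu, hgt₀]; simp
  let φ : StrongDual ℂ M := u.comp ((ContinuousMap.evalCLM ℂ t₀).comp M.subtypeL)
  have hφ : ∀ k : M, φ k = u (k.1 t₀) := fun _ => rfl
  have hφ1 : ‖φ‖ = 1 := by
    refine le_antisymm (φ.opNorm_le_bound zero_le_one fun k => ?_) ?_
    · rw [hφ, one_mul]
      refine (u.le_of_opNorm_le hu1.le _).trans ?_
      rw [one_mul]
      exact k.1.norm_coe_le_norm t₀
    · have := φ.le_opNorm g
      rwa [hφ, hu', norm_one, hg1, mul_one] at this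
  -- Slice depth `δ` gives `‖g t₀ + k t₀‖ > 2 - δ`, hence `‖g t₀ - k t₀‖ < 1`. Elsewhere on `Γ` the
  -- difference is `-k`, so `‖g - k‖ ≤ 1 < 2 - 1/2`.
  obtain ⟨δ, hδ, hconv⟩ := exists_forall_closed_ball_dist_add_le_two_sub X one_pos
  obtain ⟨k, ⟨hk1, hkφ⟩, hk⟩ := h φ hφ1 δ hδ g
    ⟨hg1.le, by rw [hφ, hu', Complex.one_re]; linarith⟩ hg1 (1 / 2) (by norm_num)
  have hkt : ∀ t, ‖k.1 t‖ ≤ 1 := fun t => (k.1.norm_coe_le_norm t).trans hk1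
  have hclose : ‖g.1 t₀ - k.1 t₀‖ < 1 := by
    by_contra hge
    have h1 := hconv hgt₀.le (hkt t₀) (not_lt.1 hge)
    have h2 : (u (g.1 t₀ + k.1 t₀)).re ≤ ‖g.1 t₀ + k.1 t₀‖ :=
      (Complex.re_le_norm _).trans ((u.le_of_opNorm_le hu1.le _).trans (by rw [one_mul]))
    rw [map_add, hu', Complex.add_re, Complex.one_re, ← hφ] at h2
    linarith
  obtain ⟨t, ht, hgt⟩ := exists_norm_eq_of_mem_shilovBoundary hM (g - k).2
  change ‖g.1 t - k.1 t‖ = ‖g - k‖ at hgt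
  rcases eq_or_ne t t₀ with rfl | htt
  · linarith
  · rw [hg0 t ht htt, zero_sub, norm_neg] at hgt
    linarith [hkt t]

theorem tendsto_inv_one_add_half_pow :
    Tendsto (fun n : ℕ => (1 + (1 / 2 : ℝ) ^ n)⁻¹) atTop (𝓝 1) := by
  have h : Tendsto (fun n : ℕ => 1 + (1 / 2 : ℝ) ^ n) atTop (𝓝 (1 + 0)) :=
    (tendsto_pow_atTop_nhds_zero_of_lt_one (by norm_num) (by norm_num)).const_add 1
  rw [add_zero] at h
  simpa using h.inv₀ one_ne_zero

/-- Weakly null perturbations whose norm is at most `1 + 2⁻ⁿ`, scaled back to the unit ball. -/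
theorem tendsto_apply_scaled {E : Type*} [NormedAddCommGroup E] [NormedSpace ℂ E]
    {x : E} {w : ℕ → E} {F : StrongDual ℂ E}
    (hw : Tendsto (fun n => F (w n)) atTop (𝓝 0)) :
    Tendsto (fun n : ℕ => F ((((1 + (1 / 2 : ℝ) ^ n)⁻¹ : ℝ) : ℂ) • (x + w n))) atTop
      (𝓝 (F x)) := by
  have h1 : Tendsto (fun n : ℕ => (((1 + (1 / 2 : ℝ) ^ n)⁻¹ : ℝ) : ℂ)) atTop (𝓝 ((1 : ℝ) : ℂ)) :=
    (Complex.continuous_ofReal.tendsto 1).comp tendsto_inv_one_add_half_pow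
  have h2 := h1.mul (hw.const_add (F x))
  simpa only [map_smul, map_add, smul_eq_mul, Complex.ofReal_one, one_mul, add_zero] using h2

theorem norm_scaled_le_one {E : Type*} [NormedAddCommGroup E] [NormedSpace ℂ E] {x : E} {n : ℕ}
    (hx : ‖x‖ ≤ 1 + (1 / 2) ^ n) : ‖(((1 + (1 / 2 : ℝ) ^ n)⁻¹ : ℝ) : ℂ) • x‖ ≤ 1 := by
  have h : (0 : ℝ) < 1 + (1 / 2) ^ n := by positivity
  rw [norm_smul, Complex.norm_real, Real.norm_of_nonneg (inv_nonneg.2 h.le), inv_mul_le_iff₀ h,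
    mul_one]
  exact hx

theorem hasDD2P_of_preperfect_shilovBoundary [T2Space K] {M : Submodule ℂ C(K, X)}
    (hM : IsFunctionSpaceOverUniformAlgebra M)
    (hΓ : Preperfect (shilovBoundary (baseAlgebra M))) : HasDD2P M := by
  rintro V hV _ rfl g ⟨-, hgV⟩ hg ε hε
  obtain ⟨ψ, p, hψp, hp, hψ, hnull⟩ := exists_seq_peak_weakly_null hM hΓ hg (ε := ε / 4)
    (by positivity)
  -- Adding `-2 ψ g` flips the sign of `g` at the peak, and `|1 - 2ψ| ≤ |1 - ψ| + |ψ|` stays below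
  -- `1 + (1/2) ^ n`.
  let w : ℕ → M := fun n => baseMul hM (ψ n) ((-2 : ℂ) • g)
  have hw : ∀ n t, (g + w n).1 t = (1 - 2 * (ψ n).1 t) • g.1 t := by
    intro n t
    change g.1 t + (w n).1 t = _
    rw [baseMul_apply]
    change g.1 t + (ψ n).1 t • ((-2 : ℂ) • g.1 t) = _
    module
  let s : ℕ → ℝ := fun n => (1 + (1 / 2 : ℝ) ^ n)⁻¹
  have hs0 : ∀ n, 0 ≤ s n := fun n => by positivity
  have hs1 : ∀ n, s n ≤ 1 := fun n =>
    inv_le_one_of_one_le₀ (le_add_of_nonneg_right (by positivity))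
  let h : ℕ → M := fun n => (s n : ℂ) • (g + w n)
  have hh1 : ∀ n, ‖h n‖ ≤ 1 := by
    intro n
    refine norm_scaled_le_one (((g + w n).1.norm_le (by positivity)).2 fun t => ?_)
    rw [hw, norm_smul]
    have h1 : ‖1 - 2 * (ψ n).1 t‖ ≤ 1 + (1 / 2) ^ n := by
      refine le_trans ?_ (hψ n t)
      have : 1 - 2 * (ψ n).1 t = (1 - (ψ n).1 t) - (ψ n).1 t := by ring
      rw [this, add_comm]
      exact norm_sub_le _ _
    have h2 : ‖g.1 t‖ ≤ 1 := (g.1.norm_coe_le_norm t).trans hg.le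
    exact (mul_le_of_le_one_right (norm_nonneg _) h2).trans h1
  have hhw : Tendsto (fun n => toWeakSpace ℂ M (h n)) atTop (𝓝 (toWeakSpace ℂ M g)) :=
    tendsto_toWeakSpace fun F => tendsto_apply_scaled (hnull _ _ (fun _ => le_rfl) F)
  have hev1 := hhw.eventually_mem (hV.mem_nhds hgV)
  have hev2 : ∀ᶠ n in atTop, 1 - ε / 4 < s n :=
    tendsto_inv_one_add_half_pow.eventually_const_lt (by linarith)
  obtain ⟨n, hnV, hns⟩ := (hev1.and hev2).exists
  refine ⟨h n, ⟨mem_closedBall_zero_iff.2 (hh1 n), hnV⟩, ?_⟩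
  have hval : (g - h n).1 (p n) = ((1 + s n : ℝ) : ℂ) • g.1 (p n) := by
    change g.1 (p n) - (s n : ℂ) • (g + w n).1 (p n) = _
    rw [hw, hψp]
    push_cast
    module
  have h1 : ‖(g - h n).1 (p n)‖ ≤ ‖g - h n‖ := (g - h n).1.norm_coe_le_norm (p n)
  rw [hval, norm_smul, Complex.norm_real, Real.norm_of_nonneg (by linarith [hs0 n])] at h1
  have h2 : ‖g.1 (p n)‖ ≤ 1 := (g.1.norm_coe_le_norm _).trans hg.le
  linarith [hp n, mul_nonneg (sub_nonneg.2 (hs1 n)) (sub_nonneg.2 h2)]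

theorem hasDaugavetProperty_of_preperfect_shilovBoundary [T2Space K] {M : Submodule ℂ C(K, X)}
    (hM : IsFunctionSpaceOverUniformAlgebra M) (hT : ContainsBaseTensor M)
    (hΓ : Preperfect (shilovBoundary (baseAlgebra M))) : HasDaugavetProperty M := by
  refine hasDaugavetProperty_of_slices fun F hF g hg α hα => ?_
  obtain ⟨ψ, p, hψp, hp, hψ, hnull⟩ := exists_seq_peak_weakly_null hM hΓ hg (ε := α / 4)
    (by positivity)
  obtain ⟨B, hB, -, -⟩ := hM.exists_subalgebra
  have h1A : (1 : C(K, ℂ)) ∈ baseAlgebra M := hB ▸ B.one_mem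
  obtain ⟨f, hf1, hfF⟩ : ∃ f : M, ‖f‖ ≤ 1 ∧ 1 - α < (F f).re := by
    obtain ⟨f, hf1, hf⟩ := F.exists_lt_apply_of_lt_opNorm (r := max 0 (1 - α))
      (by rw [hF]; exact max_lt one_pos (by linarith))
    have hf0 : F f ≠ 0 := norm_pos_iff.1 ((le_max_left _ _).trans_lt hf)
    refine ⟨((‖F f‖ : ℂ) / F f) • f, ?_, ?_⟩
    · rw [norm_smul, norm_div, Complex.norm_real, norm_norm, div_self (norm_ne_zero_iff.2 hf0),
        one_mul]
      exact hf1.le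
    · rw [map_smul, smul_eq_mul, div_mul_cancel₀ _ hf0, Complex.ofReal_re]
      exact (le_max_right _ _).trans_lt hf
  have hgp : ∀ t, ‖g.1 t‖ ≤ 1 := fun t => (g.1.norm_coe_le_norm t).trans hg.le
  have hft : ∀ t, ‖f.1 t‖ ≤ 1 := fun t => (f.1.norm_coe_le_norm t).trans hf1
  -- The tensor condition enters only here, through the constant functions with values `g (p n)`.
  let c : ℕ → M := fun n => ⟨(1 : C(K, ℂ)) • ContinuousMap.const K (g.1 (p n)), hT 1 h1A _⟩
  have hc : ∀ n t, (c n).1 t = g.1 (p n) := fun n t => by simp [c]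
  -- This perturbation moves `f` to the value `g (p n)` at the peak, so adding `g` nearly doubles
  -- the norm there, while `F` hardly changes.
  let w : ℕ → M := fun n => baseMul hM (ψ n) (c n - f)
  have hw : ∀ n t, (f + w n).1 t = (1 - (ψ n).1 t) • f.1 t + (ψ n).1 t • g.1 (p n) := by
    intro n t
    change f.1 t + (w n).1 t = _
    rw [baseMul_apply]
    change f.1 t + (ψ n).1 t • ((c n).1 t - f.1 t) = _
    rw [hc]
    module
  have hcf : ∀ n, ‖c n - f‖ ≤ 2 := by
    intro n
    have h1 : ‖c n‖ ≤ 1 := ((c n).1.norm_le zero_le_one).2 fun t => by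
      rw [hc]; exact hgp _
    linarith [norm_sub_le (c n) f]
  let s : ℕ → ℝ := fun n => (1 + (1 / 2 : ℝ) ^ n)⁻¹
  have hs0 : ∀ n, 0 ≤ s n := fun n => by positivity
  have hs1 : ∀ n, s n ≤ 1 := fun n =>
    inv_le_one_of_one_le₀ (le_add_of_nonneg_right (by positivity))
  let h : ℕ → M := fun n => (s n : ℂ) • (f + w n)
  have hh1 : ∀ n, ‖h n‖ ≤ 1 := by
    intro n
    refine norm_scaled_le_one (((f + w n).1.norm_le (by positivity)).2 fun t => ?_)
    rw [hw]
    refine (norm_add_le _ _).trans (le_trans ?_ (hψ n t))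
    rw [norm_smul, norm_smul, add_comm]
    exact add_le_add (mul_le_of_le_one_right (norm_nonneg _) (hgp _))
      (mul_le_of_le_one_right (norm_nonneg _) (hft _))
  have hhw : Tendsto (fun n => (F (h n)).re) atTop (𝓝 (F f).re) :=
    (Complex.continuous_re.tendsto _).comp (tendsto_apply_scaled (hnull _ _ hcf F))
  have hev2 : ∀ᶠ n in atTop, 1 - α / 4 < s n :=
    tendsto_inv_one_add_half_pow.eventually_const_lt (by linarith)
  obtain ⟨n, hnF, hns⟩ := ((hhw.eventually_const_lt hfF).and hev2).exists
  refine ⟨h n, ⟨hh1 n, hnF⟩, ?_⟩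
  have hval : (h n + g).1 (p n) = ((1 + s n : ℝ) : ℂ) • g.1 (p n) := by
    change (s n : ℂ) • (f + w n).1 (p n) + g.1 (p n) = _
    rw [hw, hψp]
    push_cast
    module
  have h1 : ‖(h n + g).1 (p n)‖ ≤ ‖h n + g‖ := (h n + g).1.norm_coe_le_norm (p n)
  rw [hval, norm_smul, Complex.norm_real, Real.norm_of_nonneg (by linarith [hs0 n])] at h1
  linarith [hp n, mul_nonneg (sub_nonneg.2 (hs1 n)) (sub_nonneg.2 (hgp (p n)))]

end MainTheorem

theorem mainTheorem3 {X : Type*} [NormedAddCommGroup X] [NormedSpace ℂ X] [CompleteSpace X]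
    [UniformConvexSpace X] {K : Type*} [TopologicalSpace K] [CompactSpace K] [T2Space K]
    (M : Submodule ℂ C(K, X)) (hM : IsFunctionSpaceOverUniformAlgebra M) :
    ((HasDaugavetProperty M → HasDD2P M) ∧ (HasDD2P M → HasDLD2P M) ∧
      (HasDLD2P M → Preperfect (shilovBoundary (baseAlgebra M)))) ∧
    (ContainsBaseTensor M →
      List.TFAE [HasDaugavetProperty M, HasDD2P M, HasDLD2P M,
        Preperfect (shilovBoundary (baseAlgebra M))]) := by
  have h12 : HasDaugavetProperty M → HasDD2P M := fun h =>
    hasDD2P_of_preperfect_shilovBoundary hM (preperfect_shilovBoundary_of_hasDLD2P hM h.hasDLD2P)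
  have h23 : HasDD2P M → HasDLD2P M := HasDD2P.hasDLD2P
  have h34 : HasDLD2P M → Preperfect (shilovBoundary (baseAlgebra M)) :=
    preperfect_shilovBoundary_of_hasDLD2P hM
  refine ⟨⟨h12, h23, h34⟩, fun hT => ?_⟩
  have h41 : Preperfect (shilovBoundary (baseAlgebra M)) → HasDaugavetProperty M :=
    hasDaugavetProperty_of_preperfect_shilovBoundary hM hT
  tfae_have 1 → 2 := h12
  tfae_have 2 → 3 := h23
  tfae_have 3 → 4 := h34
  tfae_have 4 → 1 := h41
  tfae_finish
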